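/- All graphs are finite and simple. Let $G=(V,E)$ be a graph with $n=|V|$ vertices and $m=|E|$ edges. For an orientation of $G$, let $A_G$ be the real matrix with rows indexed by $E$ and columns indexed by $V\cup E$ in which, for an edge $e$ oriented from $u$ to $v$, $A_G[e,y]=1$ if $y=v$ or $y\neq e$ is an edge incident to $v$; $A_G[e,y]=-1$ if $y=u$ or $y\neq e$ is an edge incident to $u$; and $A_G[e,y]=0$ otherwise. The permanent index $\mathrm{pind}(A)$ of a matrix $A$ is the minimum $k$ for which there is a square matrix $A'$ with $\mathrm{per}(A')\neq 0$ such that each column of $A'$ is a column of $A$ and each column of $A$ (columns being distinguished by their indices) occurs in $A'$ at most $k$ times; it is $\infty$ if there is no such $k$. The graph $G$ is $(2,2)$-choosable if, whenever each $z\in V\cup E$ is assigned a set $L(z)$ of two real numbers, there is $f:V\cup E\to\mathbb{R}$ with $f(z)\in L(z)$ for all $z$ such that $s(u)\neq s(v)$ for every two adjacent vertices $u,v$, where $s(v)=f(v)+\sum_{e\ni v}f(e)$. A unicyclic graph is a connected graph containing exactly one cycle. **Theorem.** For every unicyclic graph $U$ and every orientation of $U$, $\mathrm{pind}(A_U)=1$,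 and $U$ is $(2,2)$-choosable. Hence every connected graph with $m=n$ is $(2,2)$-choosable. -/

import Mathlib

/-- An orientation of a graph: each edge is directed from `source e` to `target e`. -/
structure GraphOrientation {V : Type*} (G : SimpleGraph V) where
  source : G.edgeSet → V
  target : G.edgeSet → V
  mk_eq : ∀ e : G.edgeSet, s(source e, target e) = (e : Sym2 V)

/-- The matrix `A_G` of an oriented graph: rows are indexed by the edges, columns by the vertices
and the edges. In row `e = (u, v)` the entry is `1` at `v` and at the other edges incident to `v`,
`-1` at `u` and at the other edges incident to `u`, and `0` elsewhere. -/
def totalWeightMatrix {V : Type*} [DecidableEq V] {G : SimpleGraph V} (D : GraphOrientation G) :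
    Matrix G.edgeSet (V ⊕ G.edgeSet) ℝ :=
  Matrix.of fun e z =>
    match z with
    | Sum.inl w => if w = D.target e then 1 else if w = D.source e then -1 else 0
    | Sum.inr y =>
        if y ≠ e ∧ D.target e ∈ (y : Sym2 V) then 1
        else if y ≠ e ∧ D.source e ∈ (y : Sym2 V) then -1
        else 0

/-- The permanent index of a matrix `A`: the least `k` such that some square matrix with nonzero
permanent has all its columns among the columns of `A`, each column (index) of `A` being used
at most `k` times. The column of `A` in position `i` of the square matrix is `A`'s column `f i`.
The value is `⊤` if there is no such `k`. -/
noncomputable def permanentIndex {m c : Type*} [Fintype m] [DecidableEq m] [DecidableEq c]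
    (A : Matrix m c ℝ) : ℕ∞ :=
  sInf {k : ℕ∞ | ∃ f : m → c, (A.submatrix id f).permanent ≠ 0 ∧
    ∀ z : c, ((Finset.univ.filter fun i => f i = z).card : ℕ∞) ≤ k}

/-- The total weight `s(v) = f(v) + ∑ f(e)`, over the edges `e` incident to `v`. -/
noncomputable def vertexWeight {V : Type*} [DecidableEq V] {G : SimpleGraph V}
    [Fintype G.edgeSet] (f : V ⊕ G.edgeSet → ℝ) (v : V) : ℝ :=
  f (Sum.inl v) + ∑ e : G.edgeSet, if v ∈ (e : Sym2 V) then f (Sum.inr e) else 0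

/-- A total weighting is proper if adjacent vertices have distinct weights. -/
def IsProperTotalWeighting {V : Type*} [DecidableEq V] {G : SimpleGraph V}
    [Fintype G.edgeSet] (f : V ⊕ G.edgeSet → ℝ) : Prop :=
  ∀ u v : V, G.Adj u v → vertexWeight f u ≠ vertexWeight f v

/-- Total weight `ψ`-choosability. -/
def TotalWeightChoosable {V : Type*} [DecidableEq V] (G : SimpleGraph V)
    [Fintype G.edgeSet] (ψ : V ⊕ G.edgeSet → ℕ+) : Prop :=
  ∀ L : V ⊕ G.edgeSet → Finset ℝ, (∀ z, (L z).card = ψ z) →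
    ∃ f : V ⊕ G.edgeSet → ℝ, IsProperTotalWeighting f ∧ ∀ z, f z ∈ L z

/-- Total weight `(k, k')`-choosability: lists of size `k` on vertices and `k'` on edges. -/
def TotalWeightPairChoosable {V : Type*} [DecidableEq V] (G : SimpleGraph V)
    [Fintype G.edgeSet] (k k' : ℕ+) : Prop :=
  TotalWeightChoosable G (Sum.elim (fun _ => k) (fun _ => k'))

/-- A unicyclic graph: connected, and containing exactly one cycle (as a subgraph). -/
def IsUnicyclic {V : Type*} (G : SimpleGraph V) : Prop :=
  G.Connected ∧
    ∃! H : G.Subgraph, ∃ (v : V) (c : G.Walk v v), c.IsCycle ∧ c.toSubgraph = H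

/-! Choose an edge `e₀ = ab` whose removal leaves a spanning tree, root the tree at `a`, and give
every other edge the column of its child endpoint. These columns are distinct and omit `a`; one
column for `e₀` is missing. Filling the gap with column `b` repeats a column, but the permanent is
nonzero by a triangularity argument (`Matrix.permanent_submatrix_ne_zero_of_rank`). Column `e₀` is
the sum of columns `a` and `b`, so by multilinearity filling the gap with `a` or with `e₀` gives a
nonzero permanent, and both choices are injective. Choosability follows by the Combinatorial
Nullstellensatz: the permanent is the coefficient of a squarefree monomial in the product of `s(v) -
s(u)` over the edges. -/

open Finset in
-- All nonzero terms are equal to the diagonal product, so none cancel, even when `h` repeats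
-- columns.
theorem Matrix.permanent_submatrix_ne_zero_of_rank {E W : Type*} [Fintype E] [DecidableEq E]
    (B : Matrix E W ℝ) (h : E → W) (d : W → ℕ) (hne : ∀ e, B e (h e) ≠ 0)
    (hd : ∀ e e', B e (h e') ≠ 0 → d (h e') < d (h e) ∨ h e' = h e) :
    (B.submatrix id h).permanent ≠ 0 := by
  classical
  have key : ∀ σ : Equiv.Perm E, ∏ i, B (σ i) (h i) =
      if ∀ i, B (σ i) (h i) ≠ 0 then ∏ i, B i (h i) else 0 := by
    intro σ
    split_ifs with hσ
    · have hle : ∀ i ∈ univ, d (h i) ≤ d (h (σ i)) := fun i _ => by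
        rcases hd _ _ (hσ i) with h1 | h1
        · exact h1.le
        · rw [h1]
      -- A permutation preserves the total rank, so every termwise inequality is an equality and `h
      -- (σ i) = h i`.
      have hsum : ∑ i, d (h i) = ∑ i, d (h (σ i)) :=
        (Equiv.sum_comp σ fun i => d (h i)).symm
      have heq := (sum_eq_sum_iff_of_le hle).1 hsum
      rw [← Equiv.prod_comp σ fun i => B i (h i)]
      refine prod_congr rfl fun i hi => ?_
      rcases hd _ _ (hσ i) with h1 | h1
      · exact absurd (heq i hi) h1.ne
      · rw [h1]
    · push Not at hσ
      obtain ⟨i, hi⟩ := hσ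
      exact prod_eq_zero (mem_univ i) hi
  have hper : (B.submatrix id h).permanent =
      ∑ σ : Equiv.Perm E, if ∀ i, B (σ i) (h i) ≠ 0 then ∏ i, B i (h i) else 0 :=
    sum_congr rfl fun σ _ => key σ
  rw [hper, ← sum_filter, sum_const, nsmul_eq_mul]
  refine mul_ne_zero (Nat.cast_ne_zero.2 (card_ne_zero_of_mem (a := 1) ?_))
    (prod_ne_zero_iff.2 fun i _ => hne i)
  simpa using hne

theorem Matrix.permanent_submatrix_update_add {E W : Type*} [Fintype E] [DecidableEq E]
    (B : Matrix E W ℝ) (f : E → W) (e₀ : E) (x y z : W) (hz : ∀ e, B e z = B e x + B e y) :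
    (B.submatrix id (Function.update f e₀ z)).permanent =
      (B.submatrix id (Function.update f e₀ x)).permanent +
        (B.submatrix id (Function.update f e₀ y)).permanent := by
  simp only [Matrix.permanent, ← Finset.sum_add_distrib]
  refine Finset.sum_congr rfl fun σ _ => ?_
  have split : ∀ w, ∏ i, (B.submatrix id (Function.update f e₀ w)) (σ i) i =
      B (σ e₀) w * ∏ i ∈ Finset.univ.erase e₀, B (σ i) (f i) := by
    intro w
    rw [← Finset.mul_prod_erase _ _ (Finset.mem_univ e₀)]
    congr 1
    · simp
    · refine Finset.prod_congr rfl fun i hi => ?_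
      simp [Function.update_of_ne (Finset.ne_of_mem_erase hi)]
  rw [split, split, split, hz, add_mul]

theorem SimpleGraph.Connected.exists_adj_dist_lt {V : Type*} {H : SimpleGraph V}
    (hH : H.Connected) {a v : V} (hv : v ≠ a) : ∃ p, H.Adj v p ∧ H.dist p a < H.dist v a := by
  obtain ⟨w, hw⟩ := hH.exists_walk_length_eq_dist v a
  cases w with
  | nil => exact absurd rfl hv
  | cons hadj q =>
    refine ⟨_, hadj, ?_⟩
    have := SimpleGraph.dist_le q
    rw [SimpleGraph.Walk.length_cons] at hw
    omega

/-! ### The matrix of an orientation -/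

section TotalWeightMatrix

variable {V : Type*} {G : SimpleGraph V} (D : GraphOrientation G)

theorem GraphOrientation.mem_iff (e : G.edgeSet) (v : V) :
    v ∈ (e : Sym2 V) ↔ v = D.source e ∨ v = D.target e := by
  rw [← D.mk_eq e, Sym2.mem_iff]

theorem GraphOrientation.source_ne_target (e : G.edgeSet) : D.source e ≠ D.target e := by
  have h := e.2
  rw [← D.mk_eq e] at h
  exact SimpleGraph.Adj.ne h

theorem GraphOrientation.not_source_mem_of_target_mem {e y : G.edgeSet} (hne : y ≠ e)
    (ht : D.target e ∈ (y : Sym2 V)) : D.source e ∉ (y : Sym2 V) := fun hs =>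
  hne <| Subtype.ext <| by
    rw [← D.mk_eq e]
    exact (Sym2.mem_and_mem_iff (D.source_ne_target e)).1 ⟨hs, ht⟩

variable [DecidableEq V]

theorem totalWeightMatrix_inl_ne_zero_iff (e : G.edgeSet) (v : V) :
    totalWeightMatrix D e (Sum.inl v) ≠ 0 ↔ v ∈ (e : Sym2 V) := by
  rw [D.mem_iff]
  simp only [totalWeightMatrix, Matrix.of_apply]
  split_ifs <;> simp_all

theorem totalWeightMatrix_inr (e y : G.edgeSet) :
    totalWeightMatrix D e (Sum.inr y) =
      (if D.target e ∈ (y : Sym2 V) then 1 else 0) -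
        (if D.source e ∈ (y : Sym2 V) then 1 else 0) := by
  simp only [totalWeightMatrix, Matrix.of_apply]
  by_cases hye : y = e
  · subst hye
    simp [D.mem_iff]
  · by_cases ht : D.target e ∈ (y : Sym2 V)
    · simp [hye, ht, D.not_source_mem_of_target_mem hye ht]
    · by_cases hs : D.source e ∈ (y : Sym2 V) <;> simp [hye, ht, hs]

theorem totalWeightMatrix_inl (e : G.edgeSet) (v : V) :
    totalWeightMatrix D e (Sum.inl v) =
      (if D.target e = v then 1 else 0) - (if D.source e = v then 1 else 0) := by
  have h := D.source_ne_target e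
  simp only [totalWeightMatrix, Matrix.of_apply, eq_comm (a := v)]
  split_ifs <;> simp_all

/-- This holds in row `y` too: the diagonal `0` is `1 + (-1)`. -/
theorem totalWeightMatrix_inr_eq_add (e y : G.edgeSet) {a b : V} (hy : (y : Sym2 V) = s(a, b)) :
    totalWeightMatrix D e (Sum.inr y) =
      totalWeightMatrix D e (Sum.inl a) + totalWeightMatrix D e (Sum.inl b) := by
  have hab : a ≠ b := by
    have h := y.2
    rw [hy] at h
    exact SimpleGraph.Adj.ne h
  have aux : ∀ w : V, (if w ∈ (y : Sym2 V) then (1 : ℝ) else 0) =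
      (if w = a then 1 else 0) + (if w = b then 1 else 0) := by
    intro w
    simp only [hy, Sym2.mem_iff]
    split_ifs <;> simp_all
  rw [totalWeightMatrix_inr, totalWeightMatrix_inl, totalWeightMatrix_inl, aux, aux]
  ring

theorem sum_totalWeightMatrix_mul [Fintype V] [Fintype G.edgeSet] (f : V ⊕ G.edgeSet → ℝ)
    (e : G.edgeSet) : ∑ z, totalWeightMatrix D e z * f z =
      vertexWeight f (D.target e) - vertexWeight f (D.source e) := by
  simp only [Fintype.sum_sum_type, totalWeightMatrix_inl, totalWeightMatrix_inr, sub_mul, ite_mul,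
    one_mul, zero_mul, Finset.sum_sub_distrib, Finset.sum_ite_eq, Finset.mem_univ, if_true,
    vertexWeight]
  ring

end TotalWeightMatrix

/-! ### Rooted spanning trees and a nonzero permanent -/

theorem SimpleGraph.exists_edge_labelling {V : Type*} [Fintype V] [DecidableEq V]
    {G : SimpleGraph V} [Fintype G.edgeSet] (e₀ : G.edgeSet) (a : V)
    (hconn : (G.deleteEdges {(e₀ : Sym2 V)}).Connected)
    (hcard : Fintype.card G.edgeSet = Fintype.card V) :
    ∃ h : G.edgeSet → V, ∃ d : V → ℕ,
      (∀ e e', e ≠ e₀ → e' ≠ e₀ → h e = h e' → e = e') ∧ (∀ e, e ≠ e₀ → h e ≠ a) ∧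
      ∀ e, e ≠ e₀ → ∃ p, (e : Sym2 V) = s(h e, p) ∧ d p < d (h e) := by
  classical
  set H := G.deleteEdges {(e₀ : Sym2 V)} with hH
  have hpar : ∀ v : {v : V // v ≠ a}, ∃ p, H.Adj v p ∧ H.dist p a < H.dist v a :=
    fun v => hconn.exists_adj_dist_lt v.2
  choose p hadj hlt using hpar
  have hadjG : ∀ v, G.Adj v.1 (p v) ∧ s(v.1, p v) ≠ e₀ := fun v => by
    have := hadj v
    rw [hH, SimpleGraph.deleteEdges_adj] at this
    exact this
  -- Sends `v` to its parent edge and `none` to `e₀`; with equally many edges and vertices,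
  -- injectivity suffices for bijectivity.
  let o : Option {v : V // v ≠ a} → G.edgeSet := fun x =>
    x.elim e₀ fun v => ⟨s(v.1, p v), (hadjG v).1⟩
  have hinj : Function.Injective o := by
    rintro (_ | v) (_ | w) h
    · rfl
    · exact absurd (congrArg Subtype.val h).symm (hadjG w).2
    · exact absurd (congrArg Subtype.val h) (hadjG v).2
    · have h' : s(v.1, p v) = s(w.1, p w) := congrArg Subtype.val h
      rcases Sym2.eq_iff.1 h' with ⟨h1, -⟩ | ⟨h1, h2⟩
      · rw [Subtype.ext h1]
      -- Two vertices cannot be each other's parent, since each would be strictly closer to `a`.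
      · have hv := hlt v
        have hw := hlt w
        rw [h2] at hv
        rw [← h1] at hw
        omega
  have hbij : Function.Bijective o := by
    refine (Fintype.bijective_iff_injective_and_card o).2 ⟨hinj, ?_⟩
    have : 0 < Fintype.card V := Fintype.card_pos_iff.2 ⟨a⟩
    rw [Fintype.card_option, Fintype.card_subtype_compl, Fintype.card_subtype_eq, hcard]
    omega
  have hsurj : ∀ e, e ≠ e₀ → ∃ v, o (some v) = e := by
    intro e he
    obtain ⟨x, rfl⟩ := hbij.2 e
    cases x with
    | none => exact absurd rfl he
    | some v => exact ⟨v, rfl⟩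
  choose g hg using hsurj
  refine ⟨fun e => if he : e ≠ e₀ then g e he else a, fun v => H.dist v a, ?_, ?_, ?_⟩
  · intro e e' he he' h
    simp only [he, he', ne_eq, not_false_eq_true, dite_true] at h
    rw [← hg e he, ← hg e' he', Subtype.ext h]
  · intro e he
    simp only [he, ne_eq, not_false_eq_true, dite_true]
    exact (g e he).2
  · intro e he
    simp only [he, ne_eq, not_false_eq_true, dite_true]
    exact ⟨p (g e he), (congrArg Subtype.val (hg e he)).symm, hlt _⟩

theorem exists_injective_permanent_ne_zero {V : Type*} [Fintype V] [DecidableEq V]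
    {G : SimpleGraph V} [Fintype G.edgeSet] (D : GraphOrientation G) (e₀ : G.edgeSet)
    (hconn : (G.deleteEdges {(e₀ : Sym2 V)}).Connected)
    (hcard : Fintype.card G.edgeSet = Fintype.card V) :
    ∃ f : G.edgeSet → V ⊕ G.edgeSet, Function.Injective f ∧
      ((totalWeightMatrix D).submatrix id f).permanent ≠ 0 := by
  obtain ⟨a, b, hab⟩ : ∃ a b, (e₀ : Sym2 V) = s(a, b) := ⟨_, _, (D.mk_eq e₀).symm⟩
  have hne : a ≠ b := by
    have h := e₀.2
    rw [hab] at h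
    exact SimpleGraph.Adj.ne h
  obtain ⟨h, d, hinj, ha, hp⟩ := SimpleGraph.exists_edge_labelling e₀ a hconn hcard
  set F : G.edgeSet → V ⊕ G.edgeSet := fun e => Sum.inl (h e)
  have hFinj : ∀ z, (∀ e, e ≠ e₀ → F e ≠ z) → Function.Injective (Function.update F e₀ z) := by
    intro z hz e e' hee
    by_cases he : e = e₀ <;> by_cases he' : e' = e₀
    · rw [he, he']
    · subst he
      rw [Function.update_self, Function.update_of_ne he'] at hee
      exact absurd hee.symm (hz _ he')
    · subst he'
      rw [Function.update_self, Function.update_of_ne he] at hee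
      exact absurd hee (hz _ he)
    · rw [Function.update_of_ne he, Function.update_of_ne he'] at hee
      exact hinj e e' he he' (Sum.inl_injective hee)
  have hb : ((totalWeightMatrix D).submatrix id
      (Function.update F e₀ (Sum.inl b))).permanent ≠ 0 := by
    have hupd : Function.update F e₀ (Sum.inl b) =
        Sum.inl ∘ Function.update h e₀ b := by
      rw [Function.comp_update]
      rfl
    have hna : ∀ e, Function.update h e₀ b e ≠ a := fun e => by
      by_cases he : e = e₀
      · subst he
        simpa using hne.symm
      · simpa [he] using ha e he
    rw [hupd]
    refine Matrix.permanent_submatrix_ne_zero_of_rank ((totalWeightMatrix D).submatrix id Sum.inl)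
      (Function.update h e₀ b) d ?_ ?_
    · intro e
      refine (totalWeightMatrix_inl_ne_zero_iff D e _).2 ?_
      by_cases he : e = e₀
      · subst he
        simp [hab]
      · obtain ⟨p, hep, -⟩ := hp e he
        rw [Function.update_of_ne he, hep]
        exact Sym2.mem_mk_left _ _
    · intro e e' hee
      have hmem := (totalWeightMatrix_inl_ne_zero_iff D e _).1 hee
      by_cases he : e = e₀
      -- As column `a` is absent, row `e₀` meets the chosen columns only at `b`.
      · subst he
        rw [hab, Sym2.mem_iff] at hmem
        right
        simpa using hmem.resolve_left (hna e')
      · obtain ⟨p, hep, hlt⟩ := hp e he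
        rw [hep, Sym2.mem_iff] at hmem
        rw [Function.update_of_ne he]
        rcases hmem with hm | hm
        · exact Or.inr hm
        · exact Or.inl (by rw [hm]; exact hlt)
  by_cases hA : ((totalWeightMatrix D).submatrix id
      (Function.update F e₀ (Sum.inl a))).permanent = 0
  · refine ⟨Function.update F e₀ (Sum.inr e₀), hFinj _ fun e _ => Sum.inl_ne_inr, ?_⟩
    rw [Matrix.permanent_submatrix_update_add _ F e₀ (Sum.inl a) (Sum.inl b) (Sum.inr e₀)
      fun e => totalWeightMatrix_inr_eq_add D e e₀ hab, hA, zero_add]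
    exact hb
  · exact ⟨_, hFinj _ fun e he h => ha e he (Sum.inl_injective h), hA⟩

/-- Without rows the index would be `0`, the empty permanent being `1`. -/
theorem permanentIndex_eq_one {m c : Type*} [Fintype m] [DecidableEq m] [DecidableEq c]
    [Nonempty m] (A : Matrix m c ℝ) {f : m → c} (hf : Function.Injective f)
    (hper : (A.submatrix id f).permanent ≠ 0) : permanentIndex A = 1 := by
  refine le_antisymm (sInf_le ⟨f, hper, fun z => ?_⟩) (le_sInf ?_)
  · have : (Finset.univ.filter fun i => f i = z).card ≤ 1 :=
      Finset.card_le_one.2 fun i hi j hj => hf <| by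
        rw [(Finset.mem_filter.1 hi).2, (Finset.mem_filter.1 hj).2]
    exact_mod_cast this
  · rintro k ⟨g, -, hg⟩
    obtain ⟨i⟩ := ‹Nonempty m›
    refine le_trans ?_ (hg (g i))
    have : 1 ≤ (Finset.univ.filter fun j => g j = g i).card :=
      Finset.card_pos.2 ⟨i, by simp⟩
    exact_mod_cast this

/-! ### From permanents to list weightings -/

/-- The product of the linear forms given by the rows of a matrix. -/
noncomputable def rowFormProduct {E W : Type*} [Fintype E] [Fintype W] (A : Matrix E W ℝ) :
    MvPolynomial W ℝ :=
  ∏ e, ∑ z, MvPolynomial.C (A e z) * MvPolynomial.X z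

theorem rowFormProduct_isHomogeneous {E W : Type*} [Fintype E] [Fintype W] (A : Matrix E W ℝ) :
    (rowFormProduct A).IsHomogeneous (Fintype.card E) := by
  have h := MvPolynomial.IsHomogeneous.prod Finset.univ
    (fun e : E => ∑ z, MvPolynomial.C (A e z) * MvPolynomial.X z) (fun _ => 1) fun e _ =>
      MvPolynomial.IsHomogeneous.sum _ _ _ fun z _ => MvPolynomial.isHomogeneous_C_mul_X _ _
  simpa [rowFormProduct] using h

theorem exists_perm_of_sum_single_eq {E W : Type*} [Fintype E] {f φ : E → W}
    (hf : Function.Injective f)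
    (h : ∑ e, Finsupp.single (φ e) 1 = ∑ e, Finsupp.single (f e) (1 : ℕ)) :
    ∃ σ : Equiv.Perm E, φ = f ∘ σ := by
  classical
  have hval : ∀ g : E → W, ∀ w, (∑ e, Finsupp.single (g e) (1 : ℕ)) w ≠ 0 ↔ ∃ e, g e = w := by
    intro g w
    rw [Finsupp.finsetSum_apply, Ne, Finset.sum_eq_zero_iff]
    simp [Finsupp.single_apply]
  have h1 : ∀ e, ∃ e', f e' = φ e := fun e => by
    rw [← hval, ← h, hval]
    exact ⟨e, rfl⟩
  choose τ hτ using h1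
  have hsurj : Function.Surjective τ := fun e => by
    obtain ⟨e', he'⟩ : ∃ e', φ e' = f e := by
      rw [← hval, h, hval]
      exact ⟨e, rfl⟩
    exact ⟨e', hf (by rw [hτ, he'])⟩
  exact ⟨Equiv.ofBijective τ (Finite.injective_iff_surjective.2 hsurj |> fun hi => ⟨hi, hsurj⟩),
    funext fun e => (hτ e).symm⟩

/-- Expanding the product picks a column for each row; the monomial arises exactly from the
rearrangements of `f`. -/
theorem coeff_rowFormProduct {E W : Type*} [Fintype E] [DecidableEq E] [Fintype W]
    (A : Matrix E W ℝ) {f : E → W} (hf : Function.Injective f) :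
    (rowFormProduct A).coeff (∑ e, Finsupp.single (f e) 1) = (A.submatrix id f).permanent := by
  classical
  have hmono : ∀ φ : E → W, ∏ e, (MvPolynomial.C (A e (φ e)) * MvPolynomial.X (φ e)) =
      MvPolynomial.monomial (∑ e, Finsupp.single (φ e) 1) (∏ e, A e (φ e)) := by
    intro φ
    rw [MvPolynomial.monomial_sum_index, Finset.prod_mul_distrib, map_prod]
    rfl
  rw [rowFormProduct, Fintype.prod_sum, MvPolynomial.coeff_sum, ← Matrix.permanent_transpose,
    Matrix.permanent]
  symm
  refine Finset.sum_of_injOn (fun σ : Equiv.Perm E => f ∘ σ) ?_ (fun _ _ => by simp) ?_ ?_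
  · intro σ _ τ _ h
    exact Equiv.ext fun e => hf (congrFun h e)
  · intro φ _ hφ
    rw [hmono, MvPolynomial.coeff_monomial, if_neg]
    intro h
    obtain ⟨σ, rfl⟩ := exists_perm_of_sum_single_eq hf h
    exact hφ ⟨σ, by simp, rfl⟩
  · intro σ _
    rw [hmono, MvPolynomial.coeff_monomial, if_pos]
    · rfl
    · exact Equiv.sum_comp σ fun e => Finsupp.single (f e) 1

theorem totalWeightPairChoosable_two_two {V : Type*} [Fintype V] [DecidableEq V]
    {G : SimpleGraph V} [Fintype G.edgeSet] (D : GraphOrientation G)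
    {f : G.edgeSet → V ⊕ G.edgeSet} (hf : Function.Injective f)
    (hper : ((totalWeightMatrix D).submatrix id f).permanent ≠ 0) :
    TotalWeightPairChoosable G 2 2 := by
  intro L hL
  have hcard : ∀ z, (L z).card = 2 := by
    rintro (v | e)
    · exact hL (Sum.inl v)
    · exact hL (Sum.inr e)
  set t : V ⊕ G.edgeSet →₀ ℕ := ∑ e, Finsupp.single (f e) 1 with ht
  have hcoeff : (rowFormProduct (totalWeightMatrix D)).coeff t ≠ 0 := by
    rw [coeff_rowFormProduct _ hf]
    exact hper
  have hhom := rowFormProduct_isHomogeneous (totalWeightMatrix D)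
  have hdeg : (rowFormProduct (totalWeightMatrix D)).totalDegree = t.degree := by
    rw [hhom.totalDegree (fun h => hcoeff (by rw [h, MvPolynomial.coeff_zero]))]
    simp [ht]
  -- Injectivity of `f` bounds the exponents by `1`, which is why lists of size two suffice.
  have ht1 : ∀ z, t z < (L z).card := by
    intro z
    rw [hcard, ht, Finsupp.finsetSum_apply]
    simp only [Finsupp.single_apply, Finset.sum_boole, Nat.cast_id]
    refine Nat.lt_succ_of_le (Finset.card_le_one.2 fun i hi j hj => hf ?_)
    rw [(Finset.mem_filter.1 hi).2, (Finset.mem_filter.1 hj).2]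
  obtain ⟨s, hs, hev⟩ :=
    MvPolynomial.combinatorial_nullstellensatz_exists_eval_nonzero _ t hcoeff hdeg L ht1
  refine ⟨s, fun u v huv heq => hev ?_, hs⟩
  rw [rowFormProduct, map_prod]
  refine Finset.prod_eq_zero (Finset.mem_univ ⟨s(u, v), huv⟩) ?_
  simp only [map_sum, map_mul, MvPolynomial.eval_C, MvPolynomial.eval_X]
  rw [sum_totalWeightMatrix_mul, sub_eq_zero]
  rcases Sym2.eq_iff.1 (D.mk_eq ⟨s(u, v), huv⟩) with ⟨h1, h2⟩ | ⟨h1, h2⟩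
  · rw [h1, h2, heq]
  · rw [h1, h2, heq]

/-! ### Finding the edge to delete -/

theorem nonempty_graphOrientation {V : Type*} (G : SimpleGraph V) :
    Nonempty (GraphOrientation G) :=
  ⟨⟨fun e => (e : Sym2 V).out.1, fun e => (e : Sym2 V).out.2, fun _ => Quot.out_eq _⟩⟩

theorem SimpleGraph.Connected.exists_connected_deleteEdges {V : Type*} {G : SimpleGraph V}
    (hG : G.Connected) {e : Sym2 V} (he : ¬ G.IsBridge e) : (G.deleteEdges {e}).Connected := by
  induction e with
  | h x y => exact hG.connected_delete_edge_of_not_isBridge he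

theorem IsUnicyclic.exists_isTree_deleteEdges {V : Type*} {G : SimpleGraph V}
    (hG : IsUnicyclic G) : ∃ e₀ : G.edgeSet, (G.deleteEdges {(e₀ : Sym2 V)}).IsTree := by
  obtain ⟨hconn, H, ⟨v, c, hc, hcH⟩, huniq⟩ := hG
  obtain ⟨e, he⟩ : ∃ e, e ∈ c.edges :=
    List.exists_mem_of_ne_nil _ fun h => hc.not_nil (SimpleGraph.Walk.edges_eq_nil.1 h)
  have heG := c.edges_subset_edgeSet he
  refine ⟨⟨e, heG⟩, hconn.exists_connected_deleteEdges fun hb =>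
    hb.notMem_edges_of_isCycle hc he, ?_⟩
  intro w c' hc'
  have hle := G.deleteEdges_le {e}
  -- A cycle surviving the deletion would be the unique cycle of `G`, hence would contain `e`.
  have h1 := huniq _ ⟨w, c'.mapLe hle, hc'.mapLe hle, rfl⟩
  have hmem : e ∈ (c'.mapLe hle).edges := by
    rw [← SimpleGraph.Walk.mem_edges_toSubgraph, h1, ← hcH,
      SimpleGraph.Walk.mem_edges_toSubgraph]
    exact he
  rw [SimpleGraph.Walk.edges_mapLe_eq_edges] at hmem
  have := c'.edges_subset_edgeSet hmem
  rw [SimpleGraph.edgeSet_deleteEdges] at this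
  exact this.2 rfl

theorem SimpleGraph.card_edgeSet_of_isTree_deleteEdges {V : Type*} [Fintype V] {G : SimpleGraph V}
    [Fintype G.edgeSet] {e₀ : G.edgeSet} (h : (G.deleteEdges {(e₀ : Sym2 V)}).IsTree) :
    Fintype.card G.edgeSet = Fintype.card V := by
  classical
  have h1 := (SimpleGraph.isTree_iff_connected_and_card.1 h).2
  rw [SimpleGraph.edgeSet_deleteEdges, Nat.card_eq_fintype_card (α := V)] at h1
  rw [← h1, ← Nat.card_eq_fintype_card]
  exact (Set.ncard_sdiff_singleton_add_one e₀.2).symm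

theorem theorem3p1 {V : Type*} [Fintype V] [DecidableEq V] (G : SimpleGraph V)
    [DecidableRel G.Adj] :
    (IsUnicyclic G →
      (∀ D : GraphOrientation G, permanentIndex (totalWeightMatrix D) = 1) ∧
        TotalWeightPairChoosable G 2 2) ∧
    (G.Connected → G.edgeFinset.card = Fintype.card V → TotalWeightPairChoosable G 2 2) := by
  obtain ⟨D₀⟩ := nonempty_graphOrientation G
  refine ⟨fun hG => ?_, fun hconn hcard => ?_⟩
  · obtain ⟨e₀, htree⟩ := hG.exists_isTree_deleteEdges
    have key := fun D : GraphOrientation G =>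
      exists_injective_permanent_ne_zero D e₀ htree.connected
        (SimpleGraph.card_edgeSet_of_isTree_deleteEdges htree)
    refine ⟨fun D => ?_, ?_⟩
    · obtain ⟨f, hf, hper⟩ := key D
      have : Nonempty G.edgeSet := ⟨e₀⟩
      exact permanentIndex_eq_one _ hf hper
    · obtain ⟨f, hf, hper⟩ := key D₀
      exact totalWeightPairChoosable_two_two D₀ hf hper
  -- A tree has only `n - 1` edges. The resulting non-bridge is enough here; uniqueness of the cycle
  -- plays no role.
  · have hnot : ¬ G.IsAcyclic := fun h => by
      have := SimpleGraph.IsTree.card_edgeFinset ⟨hconn, h⟩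
      omega
    rw [SimpleGraph.isAcyclic_iff_forall_isBridge] at hnot
    push Not at hnot
    obtain ⟨e, he, hb⟩ := hnot
    rw [SimpleGraph.edgeFinset_card] at hcard
    obtain ⟨f, hf, hper⟩ := exists_injective_permanent_ne_zero D₀ ⟨e, he⟩
      (hconn.exists_connected_deleteEdges hb) hcard
    exact totalWeightPairChoosable_two_two D₀ hf hper
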